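/- Let $|\tilde 0\rangle=|0\rangle$ and $|\tilde 1\rangle=\frac{1}{1+i}(|0\rangle+|1\rangle)$, and let the Barnes–Wall lattice be $BW_n=\{\sum_{\mathbf x\in\{0,1\}^n}a_{\mathbf x}\,|\tilde x_1\rangle\otimes\cdots\otimes|\tilde x_n\rangle : a_{\mathbf x}\in\mathbb Z[i]\}\subset\mathbb C^{2^n}$. For a vector $|\phi\rangle\in\mathbb C^{2^n}$ let its Barnes–Wall norm be $\mathcal N(|\phi\rangle)=\min\{\|c|\phi\rangle\|_2^2 : c\in\mathbb C\setminus\{0\},\ c|\phi\rangle\in BW_n\}$, with $\mathcal N(|\phi\rangle)=\infty$ if no such $c$ exists. Clifford gates are products of the gates $H$, $S$ and $CX$ on arbitrary qubits, $CS=\mathrm{diag}(1,1,1,i)$, and $|CS\rangle=\frac12(|00\rangle+|01\rangle+|10\rangle+i|11\rangle)$. Consider protocols that start from the all-zeros state of $n$ output qubits and any number $a\ge 0$ of ancilla qubits and apply Clifford gates, $CS$ gates and, if intermediate measurements are allowed, single-qubit computational-basis measurements on whose outcomes all later operations may depend. Such a protocol prepares an $n$-qubit state $|\phi\rangle$ exactly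 if for every sequence of measurement outcomes of nonzero probability its final state is of the form $|\phi\rangle\otimes|\chi\rangle$ for some ancilla vector $|\chi\rangle$ (which may depend on the outcomes, and contains the phase). Then $\mathcal N(|CS\rangle)=2$, and for every normalized $n$-qubit state $|\phi\rangle$ and every $m\ge 0$: 1. If $|\phi\rangle$ is prepared exactly by such a protocol without measurements that uses at most $m$ $CS$ gates, then $\mathcal N(|\phi\rangle)$ is a positive integer and $$\mathcal N(|\phi\rangle)\ \big|\ \mathcal N(|CS\rangle)^m=2^m .$$ 2. If $|\phi\rangle$ is prepared exactly by such a protocol, with intermediate measurements allowed, that uses at most $m$ $CS$ gates for every sequence of measurement outcomes, then $\mathcal N(|\phi\rangle)\le 2^m$. -/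

import Mathlib

noncomputable section

namespace BarnesWall

/-- Pure (possibly unnormalized) state vectors of a register whose qubits are labelled by `ι`:
the space with orthonormal basis the bit strings `ι → Bool` and the Euclidean norm. -/
abbrev QState (ι : Type) [Fintype ι] := EuclideanSpace ℂ (ι → Bool)

section Register

variable {ι κ : Type} [Fintype ι] [Fintype κ]

/-- The tensor product `φ ⊗ χ` on the disjoint union of two registers. -/
def tensor (φ : QState ι) (χ : QState κ) : QState (ι ⊕ κ) :=
  WithLp.toLp 2 fun x => φ (fun i => x (Sum.inl i)) * χ (fun j => x (Sum.inr j))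

/-- The all-zeros state `|0…0⟩`. -/
def ketZero (ι : Type) [Fintype ι] : QState ι :=
  WithLp.toLp 2 fun x => if x = fun _ => false then 1 else 0

/-- The product vector `⨂ᵢ |x̃ᵢ⟩`, with `|x̃ᵢ⟩ = |0⟩` if `xᵢ = 0` and
`|x̃ᵢ⟩ = (|0⟩ + |1⟩) / (1 + i)` if `xᵢ = 1`. -/
def tildeKet (x : ι → Bool) : QState ι :=
  WithLp.toLp 2 fun y =>
    ∏ i, if x i then 1 / (1 + Complex.I) else if y i then 0 else 1

/-- The Barnes–Wall lattice: all `ℤ[i]`-linear combinations of the vectors `tildeKet x`. -/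
def lattice (ι : Type) [Fintype ι] [DecidableEq ι] : Set (QState ι) :=
  {v | ∃ a : (ι → Bool) → GaussianInt, v = ∑ x, GaussianInt.toComplex (a x) • tildeKet x}

/-- The Barnes–Wall norm: the least squared length of a nonzero complex multiple of `φ` that lies
on the lattice, and `∞` if there is none. (The squared lengths of lattice vectors are integer
multiples of a fixed positive number, so the infimum of a nonempty set of them is attained.) -/
def bwNorm [DecidableEq ι] (φ : QState ι) : ENNReal :=
  sInf {r | ∃ c : ℂ, c ≠ 0 ∧ c • φ ∈ lattice ι ∧ r = ENNReal.ofReal (‖c • φ‖ ^ 2)}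

end Register

/-- The magic state `|CS⟩ = (|00⟩ + |01⟩ + |10⟩ + i|11⟩) / 2`. -/
def ketCS : QState (Fin 2) :=
  WithLp.toLp 2 fun x => (1 / 2) * if x 0 ∧ x 1 then Complex.I else 1

/-- The elementary gates: the generators `H`, `S`, `CX` of the Clifford group, and the `CS` gate.
The inverse of each Clifford generator is a power of it, so products of `H`, `S`, `CX` gates give
the whole Clifford group. For `CX`, the first qubit is the control. -/
inductive Gate (ι : Type) where
  | H (j : ι)
  | S (j : ι)
  | CX (c t : ι) (hct : c ≠ t)
  | CS (c t : ι) (hct : c ≠ t)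

section Circuits

variable {ι : Type} [Fintype ι] [DecidableEq ι]

/-- The action of a gate on state vectors. -/
def Gate.apply : Gate ι → QState ι → QState ι
  | .H j, ψ => WithLp.toLp 2 fun x =>
      (1 / (Real.sqrt 2 : ℂ)) *
        (ψ (Function.update x j false) +
          (if x j then -1 else 1) * ψ (Function.update x j true))
  | .S j, ψ => WithLp.toLp 2 fun x => (if x j then Complex.I else 1) * ψ x
  | .CX c t _, ψ => WithLp.toLp 2 fun x =>
      ψ (if x c then Function.update x t (!(x t)) else x)
  | .CS c t _, ψ => WithLp.toLp 2 fun x => (if x c ∧ x t then Complex.I else 1) * ψ x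

/-- `1` for a `CS` gate, `0` for a Clifford gate. -/
def Gate.cost : Gate ι → ℕ
  | .CS _ _ _ => 1
  | _ => 0

/-- The projection of `ψ` onto the outcome `b` of a computational-basis measurement of qubit `j`.
It is not renormalized, so its squared length carries the probability of the outcome. -/
def project (j : ι) (b : Bool) (ψ : QState ι) : QState ι :=
  WithLp.toLp 2 fun x => if x j = b then ψ x else 0

/-- Adaptive protocols: gates, and single-qubit computational-basis measurements after which the
protocol continues depending on the outcome. (Measurements of other Pauli operators are obtained
by conjugating with Clifford gates.) -/
inductive Protocol (ι : Type) where
  | done : Protocol ι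
  | gate (g : Gate ι) (P : Protocol ι) : Protocol ι
  | measure (j : ι) (P : Bool → Protocol ι) : Protocol ι

/-- The protocol performs no measurement, i.e. it is a circuit of gates. -/
def Protocol.MeasurementFree : Protocol ι → Prop
  | .done => True
  | .gate _ P => P.MeasurementFree
  | .measure _ _ => False

/-- The number of `CS` gates used, in the worst case over the measurement outcomes. -/
def Protocol.csCount : Protocol ι → ℕ
  | .done => 0
  | .gate g P => g.cost + P.csCount
  | .measure _ P => max (P false).csCount (P true).csCount

/-- The (unnormalized) final states of a protocol run on `ψ`, over all sequences of measurement
outcomes; the final state is `0` for a sequence of probability `0`. -/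
def Protocol.finals : Protocol ι → QState ι → Set (QState ι)
  | .done, ψ => {ψ}
  | .gate g P, ψ => P.finals (g.apply ψ)
  | .measure j P, ψ => ⋃ b : Bool, (P b).finals (project j b ψ)

end Circuits

/-- The protocol, run on `|0…0⟩` of `n` output and `a` ancilla qubits, prepares `φ` exactly:
for every sequence of measurement outcomes of nonzero probability, the output register ends in
the state `φ` (up to a scalar), unentangled with the ancillas, whose final state is arbitrary. -/
def Protocol.Prepares {n a : ℕ} (P : Protocol (Fin n ⊕ Fin a)) (φ : QState (Fin n)) : Prop :=
  ∀ Ψ ∈ P.finals (ketZero (Fin n ⊕ Fin a)), Ψ ≠ 0 → ∃ χ : QState (Fin a), Ψ = tensor φ χ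

end BarnesWall

end

/-! The proof follows the squared length of a lattice multiple of the current state. Multiplication
by `1 + i`, which doubles squared lengths, makes every computational-basis projector preserve the
lattice. Hence Clifford gates preserve the lattice up to a phase, and `CS` does so after one factor
`1 + i` (`exists_smul_gate_apply_mem_lattice`). A measurement splits the squared length between two
outcomes, so some nonzero outcome, suitably rescaled, stays on the lattice without getting longer
(`exists_smul_project_mem_lattice`). From `|0…0⟩`, of length 1, some branch therefore ends in `φ ⊗
χ` with a lattice multiple of squared length at most `2 ^ csCount`, with equality if nothing is
measured.

Since `ℤ[i]` is a principal ideal domain, this multiple is a product of lattice vectors `v ⊗ w` with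
`‖v‖²` the Barnes–Wall norm of `φ` (`exists_factor_of_tensor_mem_lattice`). Nonzero lattice vectors
have length at least 1 (`one_le_norm_sq`), which gives the bound. Without measurements, `‖v‖²` and
`‖w‖²` are dyadic rationals at least 1 whose product is a power of 2, so `‖v‖²` is an integer
dividing it. -/

noncomputable section

namespace BarnesWall

open Finset

/-! ### Coordinates in the lattice basis -/

section Coefficients

variable {ι : Type} [Fintype ι]

/-- The coordinates of `|x̃⟩` in the computational basis. -/
def tildeEntry (x y : Bool) : ℂ :=
  if x then 1 / (1 + Complex.I) else if y then 0 else 1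

/-- The inverse of the matrix `tildeEntry`. -/
def dualEntry (x y : Bool) : ℂ :=
  if x then (if y then 1 + Complex.I else 0) else (if y then -1 else 1)

theorem one_add_I_ne_zero : (1 + Complex.I : ℂ) ≠ 0 := by
  intro h
  simpa using congrArg Complex.re h

theorem normSq_one_add_I : ‖(1 + Complex.I : ℂ)‖ ^ 2 = 2 := by
  rw [← Complex.normSq_eq_norm_sq]
  norm_num [Complex.normSq_apply]

theorem tildeKet_apply (x y : ι → Bool) :
    tildeKet x y = ∏ i, tildeEntry (x i) (y i) := rfl

theorem dualEntry_mul_tildeEntry (x x' : Bool) :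
    ∑ b, dualEntry x' b * tildeEntry x b = if x' = x then 1 else 0 := by
  have := one_add_I_ne_zero
  cases x <;> cases x' <;> simp [dualEntry, tildeEntry, this]

theorem tildeEntry_mul_dualEntry (y y' : Bool) :
    ∑ b, dualEntry b y' * tildeEntry b y = if y' = y then 1 else 0 := by
  have := one_add_I_ne_zero
  cases y <;> cases y' <;> simp [dualEntry, tildeEntry, this]

theorem prod_ite_eq_one (x y : ι → Bool) :
    (∏ i, if x i = y i then (1 : ℂ) else 0) = if x = y then 1 else 0 := by
  rw [Finset.prod_ite_zero]
  simp [funext_iff]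

variable [DecidableEq ι]

/-- The coefficient of `v` at `tildeKet x`, in the basis of the vectors `tildeKet`. -/
def coeff (v : QState ι) (x : ι → Bool) : ℂ := ∑ y, (∏ i, dualEntry (x i) (y i)) * v y

theorem coeff_smul (c : ℂ) (v : QState ι) (x : ι → Bool) : coeff (c • v) x = c * coeff v x := by
  simp only [coeff, PiLp.smul_apply, smul_eq_mul, Finset.mul_sum]
  exact Finset.sum_congr rfl fun _ _ => by ring

theorem coeff_sum_tildeKet (a : (ι → Bool) → ℂ) (x' : ι → Bool) :
    coeff (∑ x, a x • tildeKet x) x' = a x' := by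
  simp only [coeff, WithLp.ofLp_sum, WithLp.ofLp_smul, Finset.sum_apply, Pi.smul_apply,
    smul_eq_mul, Finset.mul_sum, tildeKet_apply]
  rw [Finset.sum_comm]
  have key (x : ι → Bool) : ∑ y : ι → Bool, (∏ i, dualEntry (x' i) (y i)) *
      (a x * ∏ i, tildeEntry (x i) (y i)) = if x' = x then a x else 0 := by
    have h := Fintype.prod_sum fun (i : ι) (b : Bool) => dualEntry (x' i) b * tildeEntry (x i) b
    simp only [dualEntry_mul_tildeEntry, prod_ite_eq_one] at h
    have : ∑ y : ι → Bool, (∏ i, dualEntry (x' i) (y i)) * (a x * ∏ i, tildeEntry (x i) (y i))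
        = a x * ∑ y : ι → Bool, ∏ i, dualEntry (x' i) (y i) * tildeEntry (x i) (y i) := by
      simp only [Finset.mul_sum, Finset.prod_mul_distrib]
      exact Finset.sum_congr rfl fun _ _ => by ring
    rw [this, ← h]
    simp
  simp [key]

theorem sum_coeff_smul_tildeKet (v : QState ι) : ∑ x, coeff v x • tildeKet x = v := by
  ext y
  simp only [coeff, WithLp.ofLp_sum, WithLp.ofLp_smul, Finset.sum_apply, Pi.smul_apply,
    smul_eq_mul, Finset.sum_mul, tildeKet_apply]
  rw [Finset.sum_comm]
  have key (y' : ι → Bool) : ∑ x : ι → Bool, (∏ i, dualEntry (x i) (y' i)) * v y' *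
      (∏ i, tildeEntry (x i) (y i)) = if y' = y then v y' else 0 := by
    have h := Fintype.prod_sum fun (i : ι) (b : Bool) => dualEntry b (y' i) * tildeEntry b (y i)
    simp only [tildeEntry_mul_dualEntry, prod_ite_eq_one] at h
    have : ∑ x : ι → Bool, (∏ i, dualEntry (x i) (y' i)) * v y' * (∏ i, tildeEntry (x i) (y i))
        = v y' * ∑ x : ι → Bool, ∏ i, dualEntry (x i) (y' i) * tildeEntry (x i) (y i) := by
      simp only [Finset.mul_sum, Finset.prod_mul_distrib]
      exact Finset.sum_congr rfl fun _ _ => by ring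
    rw [this, ← h]
    simp
  simp [key]

theorem mem_lattice_iff {v : QState ι} :
    v ∈ lattice ι ↔ ∀ x, ∃ z : GaussianInt, coeff v x = z.toComplex := by
  constructor
  · rintro ⟨a, rfl⟩ x
    exact ⟨a x, coeff_sum_tildeKet (fun x => (a x).toComplex) x⟩
  · intro h
    choose a ha using h
    refine ⟨a, ?_⟩
    simp only [← ha]
    exact (sum_coeff_smul_tildeKet v).symm

theorem coeff_ne_zero_of_ne_zero {v : QState ι} (hv : v ≠ 0) : ∃ x, coeff v x ≠ 0 := by
  by_contra! h
  apply hv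
  rw [← sum_coeff_smul_tildeKet v]
  simp [h]

theorem tildeKet_mem_lattice (x : ι → Bool) : tildeKet x ∈ lattice ι := by
  refine ⟨Pi.single x 1, ?_⟩
  rw [Finset.sum_eq_single x]
  · simp
  · intro b _ hb
    simp [Pi.single_eq_of_ne hb]
  · simp

theorem zero_mem_lattice : (0 : QState ι) ∈ lattice ι := ⟨0, by simp⟩

theorem add_mem_lattice {v w : QState ι} (hv : v ∈ lattice ι) (hw : w ∈ lattice ι) :
    v + w ∈ lattice ι := by
  obtain ⟨a, rfl⟩ := hv
  obtain ⟨b, rfl⟩ := hw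
  exact ⟨a + b, by simp [add_smul, Finset.sum_add_distrib]⟩

theorem smul_mem_lattice (z : GaussianInt) {v : QState ι} (hv : v ∈ lattice ι) :
    z.toComplex • v ∈ lattice ι := by
  obtain ⟨a, rfl⟩ := hv
  exact ⟨fun x => z * a x, by simp [Finset.smul_sum, smul_smul]⟩

theorem sum_mem_lattice {α : Type*} (s : Finset α) {f : α → QState ι}
    (hf : ∀ x ∈ s, f x ∈ lattice ι) : ∑ x ∈ s, f x ∈ lattice ι :=
  Finset.sum_induction f (· ∈ lattice ι) (fun _ _ => add_mem_lattice) zero_mem_lattice hf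

theorem map_mem_lattice (F : QState ι →ₗ[ℂ] QState ι) (hF : ∀ x, F (tildeKet x) ∈ lattice ι)
    {v : QState ι} (hv : v ∈ lattice ι) : F v ∈ lattice ι := by
  obtain ⟨a, rfl⟩ := hv
  rw [map_sum]
  refine sum_mem_lattice _ fun x _ => ?_
  rw [map_smul]
  exact smul_mem_lattice _ (hF x)

end Coefficients

/-! ### Gates and projections acting on the lattice -/

section OneQubit

variable {ι : Type} [Fintype ι] [DecidableEq ι]

/-- The `2 × 2` matrix `M` acting on qubit `j`. -/
def oneQubit (j : ι) (M : Bool → Bool → ℂ) : QState ι →ₗ[ℂ] QState ι where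
  toFun v := WithLp.toLp 2 fun y => ∑ b, M (y j) b * v (Function.update y j b)
  map_add' v w := by
    ext y
    simp only [PiLp.add_apply, mul_add, Finset.sum_add_distrib]
  map_smul' c v := by
    ext y
    simp only [PiLp.smul_apply, smul_eq_mul, Finset.mul_sum, RingHom.id_apply]
    exact Finset.sum_congr rfl fun _ _ => by ring

theorem oneQubit_apply (j : ι) (M : Bool → Bool → ℂ) (v : QState ι) (y : ι → Bool) :
    oneQubit j M v y = ∑ b, M (y j) b * v (Function.update y j b) := rfl

theorem tildeKet_update_update (j : ι) (x y : ι → Bool) (b c : Bool) :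
    tildeKet (Function.update x j b) (Function.update y j c) =
      tildeEntry b c * ∏ i ∈ univ.erase j, tildeEntry (x i) (y i) := by
  rw [tildeKet_apply, ← Finset.mul_prod_erase _ _ (mem_univ j)]
  simp only [Function.update_self]
  congr 1
  refine Finset.prod_congr rfl fun i hi => ?_
  rw [Function.update_of_ne (ne_of_mem_erase hi), Function.update_of_ne (ne_of_mem_erase hi)]

/-- Hypothesis `h` says that `M` has the Gaussian-integer matrix `p` in the basis `|0̃⟩, |1̃⟩`; the
other tensor factors are untouched. -/
theorem oneQubit_mem_lattice (j : ι) (M : Bool → Bool → ℂ) (p : Bool → Bool → GaussianInt)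
    (h : ∀ x y, ∑ b, M y b * tildeEntry x b = ∑ b, (p x b).toComplex * tildeEntry b y)
    {v : QState ι} (hv : v ∈ lattice ι) : oneQubit j M v ∈ lattice ι := by
  refine map_mem_lattice _ (fun x => ?_) hv
  have : oneQubit j M (tildeKet x) =
      ∑ b, (p (x j) b).toComplex • tildeKet (Function.update x j b) := by
    ext y
    have h1 (b : Bool) := tildeKet_update_update j x y (x j) b
    have h2 (b : Bool) := tildeKet_update_update j x y b (y j)
    simp only [Function.update_eq_self] at h1 h2
    simp only [oneQubit_apply, h1, WithLp.ofLp_sum, WithLp.ofLp_smul, Finset.sum_apply,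
      Pi.smul_apply, smul_eq_mul, h2, ← mul_assoc, ← Finset.sum_mul, h]
  rw [this]
  exact sum_mem_lattice _ fun b _ => smul_mem_lattice _ (tildeKet_mem_lattice _)

theorem smul_project_mem_lattice (j : ι) (b : Bool) {v : QState ι} (hv : v ∈ lattice ι) :
    (1 + Complex.I) • project j b v ∈ lattice ι := by
  have h := oneQubit_mem_lattice j
    (fun y c => if y = b ∧ c = b then 1 + Complex.I else 0)
    -- Since `(1+i)|1̃⟩ = |0⟩ + |1⟩`, the image of `|1̃⟩` is `|0̃⟩` for outcome 0 and `|1⟩ =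
    -- (1+i)|1̃⟩ - |0̃⟩` for outcome 1.
    (fun x c => if b then (if x then (if c then ⟨1, 1⟩ else -1) else 0)
      else (if c then 0 else if x then 1 else ⟨1, 1⟩))
    (by
      have := one_add_I_ne_zero
      intro x y
      cases x <;> cases y <;> cases b <;>
        simp [tildeEntry, GaussianInt.toComplex_def, this]) hv
  convert h using 1
  ext y
  rw [oneQubit_apply]
  have hy : Function.update y j (y j) = y := Function.update_eq_self _ _
  cases b <;> cases hj : y j <;> rw [hj] at hy <;> simp [project, hj, hy]

/-- The scalar is a phase. It turns the prefactor `1/√2` into `(1-i)/2 = 1/(1+i)`, so that `|0̃⟩ ↦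
|1̃⟩` and `|1̃⟩ ↦ -i|0̃⟩`. -/
theorem smul_H_mem_lattice (j : ι) {v : QState ι} (hv : v ∈ lattice ι) :
    ((1 - Complex.I) / (Real.sqrt 2 : ℂ)) • (Gate.H j).apply v ∈ lattice ι := by
  have h2 : (Real.sqrt 2 : ℂ) * (Real.sqrt 2 : ℂ) = 2 := by
    rw [← Complex.ofReal_mul]; simp
  have h0 : (Real.sqrt 2 : ℂ) ≠ 0 := by
    intro h; simp [h] at h2
  have h := oneQubit_mem_lattice j
    (fun y c => (1 - Complex.I) / 2 * if y ∧ c then -1 else 1)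
    (fun x c => if x then (if c then 0 else ⟨0, -1⟩) else (if c then 1 else 0))
    (by
      have := one_add_I_ne_zero
      intro x y
      cases x <;> cases y <;>
        simp [tildeEntry, GaussianInt.toComplex_def] <;> field_simp <;> ring_nf <;>
        simp [Complex.I_sq] <;> ring_nf) hv
  convert h using 1
  ext y
  rw [oneQubit_apply]
  simp only [Gate.apply, PiLp.smul_apply, smul_eq_mul, Fintype.sum_bool]
  have e : (1 - Complex.I) / (Real.sqrt 2 : ℂ) * (1 / (Real.sqrt 2 : ℂ)) = (1 - Complex.I) / 2 := by
    rw [div_mul_div_comm, h2, mul_one]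
  rw [← mul_assoc, e]
  cases y j <;> simp <;> ring

/-- `(X - 1) / (1 + i)` on qubit `j`, which maps the lattice to itself. -/
def flipDiff (j : ι) : QState ι →ₗ[ℂ] QState ι :=
  oneQubit j fun y c => (if y = c then -1 else 1) / (1 + Complex.I)

theorem flipDiff_mem_lattice (j : ι) {v : QState ι} (hv : v ∈ lattice ι) :
    flipDiff j v ∈ lattice ι := by
  refine oneQubit_mem_lattice j _
    (fun x c => if x then 0 else if c then 1 else ⟨-1, 1⟩) ?_ hv
  have := one_add_I_ne_zero
  intro x y
  cases x <;> cases y <;>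
    simp [tildeEntry, GaussianInt.toComplex_def] <;> field_simp <;> ring_nf <;>
    simp [Complex.I_sq]

/-- With `Π` the projection onto `|1⟩`, `S = 1 + i·(1+i)Π`. -/
theorem S_mem_lattice (j : ι) {v : QState ι} (hv : v ∈ lattice ι) :
    (Gate.S j).apply v ∈ lattice ι := by
  have h := add_mem_lattice hv (smul_mem_lattice ⟨0, 1⟩ (smul_project_mem_lattice j true hv))
  convert h using 1
  ext y
  simp only [Gate.apply, project, PiLp.add_apply, PiLp.smul_apply, smul_eq_mul,
    GaussianInt.toComplex_def]
  cases y j <;> simp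
  linear_combination (-v.ofLp y) * Complex.I_sq

/-- `CS = 1 + i(1+i)Π_c Π_t`, where two projections share a single factor `1 + i`; the extra scalar
supplies the second one. -/
theorem smul_CS_mem_lattice (c t : ι) (hct : c ≠ t) {v : QState ι} (hv : v ∈ lattice ι) :
    (1 + Complex.I) • (Gate.CS c t hct).apply v ∈ lattice ι := by
  have h := add_mem_lattice (smul_mem_lattice ⟨1, 1⟩ hv) (smul_mem_lattice ⟨0, 1⟩
    (smul_project_mem_lattice c true (smul_project_mem_lattice t true hv)))
  convert h using 1
  ext y
  simp only [Gate.apply, project, PiLp.add_apply, PiLp.smul_apply, smul_eq_mul,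
    GaussianInt.toComplex_def]
  cases y c <;> cases y t <;> simp
  linear_combination (-v.ofLp y * (1 + Complex.I)) * Complex.I_sq

/-- `CX = 1 + Π_c (X_t - 1)`, and the factor `1 + i` needed by `Π_c` is taken out of `X_t - 1`. -/
theorem CX_mem_lattice (c t : ι) (hct : c ≠ t) {v : QState ι} (hv : v ∈ lattice ι) :
    (Gate.CX c t hct).apply v ∈ lattice ι := by
  have h := add_mem_lattice hv (smul_project_mem_lattice c true (flipDiff_mem_lattice t hv))
  convert h using 1
  ext y
  have := one_add_I_ne_zero
  have hy : Function.update y t (y t) = y := Function.update_eq_self _ _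
  simp only [Gate.apply, project, PiLp.add_apply, PiLp.smul_apply, smul_eq_mul, flipDiff,
    oneQubit_apply]
  cases y c
  · simp
  · cases ht : y t <;> rw [ht] at hy <;> simp [hy] <;> field_simp <;> ring

theorem norm_sq_eq_sum (v : QState ι) : ‖v‖ ^ 2 = ∑ x, ‖v x‖ ^ 2 := EuclideanSpace.norm_sq_eq v

/-- Flipping bit `j` permutes the bit strings. This groups amplitudes into the pairs mixed by `H`,
to which the parallelogram law applies. -/
theorem two_mul_sum_eq_sum_update (j : ι) (f : (ι → Bool) → ℝ) :
    2 * ∑ x, f x = ∑ x, (f (Function.update x j false) + f (Function.update x j true)) := by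
  have hinv : Function.Involutive fun x : ι → Bool => Function.update x j (!x j) := by
    intro x
    simp
  have h := Equiv.sum_comp hinv.toPerm f
  rw [two_mul]
  nth_rewrite 2 [← h]
  rw [← Finset.sum_add_distrib]
  refine Finset.sum_congr rfl fun x _ => ?_
  have hx : Function.update x j (x j) = x := Function.update_eq_self _ _
  cases hj : x j <;> rw [hj] at hx <;> simp [hj, hx, add_comm]

theorem norm_gate_apply (g : Gate ι) (v : QState ι) : ‖g.apply v‖ = ‖v‖ := by
  rw [← sq_eq_sq₀ (norm_nonneg _) (norm_nonneg _), norm_sq_eq_sum, norm_sq_eq_sum]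
  cases g with
  | H j =>
    refine mul_left_cancel₀ (two_ne_zero (α := ℝ)) ?_
    rw [two_mul_sum_eq_sum_update j, two_mul_sum_eq_sum_update j]
    refine Finset.sum_congr rfl fun x _ => ?_
    have hp := parallelogram_law_with_norm ℝ (v (Function.update x j false))
      (v (Function.update x j true))
    have hs : ‖(1 / (Real.sqrt 2 : ℂ))‖ ^ 2 = 1 / 2 := by
      rw [norm_div, div_pow]; simp
    simp only [Gate.apply, Function.update_self, Function.update_idem, norm_mul, mul_pow, hs]
    simp only [Bool.false_eq_true, if_true, if_false, one_mul, neg_one_mul, ← sub_eq_add_neg]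
    linarith
  | S j =>
    refine Finset.sum_congr rfl fun x _ => ?_
    simp only [Gate.apply]
    split <;> simp
  | CX c t hct =>
    have hinv : Function.Involutive fun x : ι → Bool =>
        if x c then Function.update x t (!x t) else x := by
      intro x
      cases hc : x c <;> simp [hc, hct]
    exact Equiv.sum_comp hinv.toPerm fun x => ‖v x‖ ^ 2
  | CS c t hct =>
    refine Finset.sum_congr rfl fun x _ => ?_
    simp only [Gate.apply]
    split <;> simp

theorem exists_smul_gate_apply_mem_lattice (g : Gate ι) :
    ∃ u : ℂ, ‖u‖ ^ 2 = 2 ^ g.cost ∧ ∀ v ∈ lattice ι, u • g.apply v ∈ lattice ι := by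
  cases g with
  | H j =>
    refine ⟨(1 - Complex.I) / (Real.sqrt 2 : ℂ), ?_, fun v hv => smul_H_mem_lattice j hv⟩
    rw [← Complex.normSq_eq_norm_sq]
    norm_num [Gate.cost, Complex.normSq_apply]
  | S j => exact ⟨1, by simp [Gate.cost], fun v hv => by simpa using S_mem_lattice j hv⟩
  | CX c t hct =>
    exact ⟨1, by simp [Gate.cost], fun v hv => by simpa using CX_mem_lattice c t hct hv⟩
  | CS c t hct =>
    exact ⟨1 + Complex.I, by simp [Gate.cost, normSq_one_add_I],
      fun v hv => smul_CS_mem_lattice c t hct hv⟩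

theorem gate_apply_smul (g : Gate ι) (c : ℂ) (v : QState ι) :
    g.apply (c • v) = c • g.apply v := by
  ext x
  cases g <;> simp only [Gate.apply, PiLp.smul_apply, smul_eq_mul] <;> ring

theorem project_smul (j : ι) (b : Bool) (c : ℂ) (v : QState ι) :
    project j b (c • v) = c • project j b v := by
  ext x
  simp [project]

theorem norm_sq_project_add (j : ι) (v : QState ι) :
    ‖project j false v‖ ^ 2 + ‖project j true v‖ ^ 2 = ‖v‖ ^ 2 := by
  simp only [norm_sq_eq_sum, ← Finset.sum_add_distrib]
  refine Finset.sum_congr rfl fun x _ => ?_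
  cases hj : x j <;> simp [project, hj]

theorem project_add_project (j : ι) (b : Bool) (v : QState ι) :
    project j b v + project j (!b) v = v := by
  ext x
  cases b <;> cases hj : x j <;> simp [project, hj]

/-- Some outcome of a measurement of a lattice vector does not increase the length, after
rescaling to a lattice vector. -/
theorem exists_smul_project_mem_lattice (j : ι) {v : QState ι} (hv : v ∈ lattice ι)
    (h0 : v ≠ 0) : ∃ (b : Bool) (u : ℂ), u ≠ 0 ∧ project j b v ≠ 0 ∧
      u • project j b v ∈ lattice ι ∧ ‖u • project j b v‖ ^ 2 ≤ ‖v‖ ^ 2 := by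
  -- The shorter projection might vanish; in that case the other one is `v` itself and needs no
  -- rescaling.
  by_cases hz : ∃ b, project j b v = 0
  · obtain ⟨b, hb⟩ := hz
    have h := project_add_project j b v
    rw [hb, zero_add] at h
    exact ⟨!b, 1, one_ne_zero, by rwa [h], by rwa [h, one_smul], by rw [h, one_smul]⟩
  · push Not at hz
    have hs := norm_sq_project_add j v
    -- One outcome carries at most half of the squared length, which pays for the doubling by `1 +
    -- i`.
    have : ∃ b, 2 * ‖project j b v‖ ^ 2 ≤ ‖v‖ ^ 2 := by
      by_contra! h
      linarith [h false, h true]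
    obtain ⟨b, hb⟩ := this
    refine ⟨b, 1 + Complex.I, one_add_I_ne_zero, hz b, smul_project_mem_lattice j b hv, ?_⟩
    rwa [norm_smul, mul_pow, normSq_one_add_I]

end OneQubit

/-! ### Minimal length and dyadic squared lengths -/

section MinimalNorm

variable {ι : Type} [Fintype ι] [DecidableEq ι]

theorem one_le_norm_sq_toComplex {z : GaussianInt} (hz : z ≠ 0) : 1 ≤ ‖z.toComplex‖ ^ 2 := by
  rw [← Complex.normSq_eq_norm_sq, ← GaussianInt.intCast_real_norm]
  exact_mod_cast GaussianInt.norm_pos.2 hz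

/-- The qubits of `s` are measured one at a time, always keeping an outcome that does not lengthen
the vector. -/
theorem exists_measured_mem_lattice (s : Finset ι) {v : QState ι} (hv : v ∈ lattice ι)
    (h0 : v ≠ 0) : ∃ w ∈ lattice ι, w ≠ 0 ∧ ‖w‖ ^ 2 ≤ ‖v‖ ^ 2 ∧
      ∃ x : ι → Bool, ∀ y, w y ≠ 0 → ∀ j ∈ s, y j = x j := by
  induction s using Finset.induction_on with
  | empty => exact ⟨v, hv, h0, le_rfl, fun _ => false, by simp⟩
  | insert j s hj ih =>
    obtain ⟨w, hw, hw0, hle, x, hx⟩ := ih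
    obtain ⟨b, u, hu, hp, hm, hle'⟩ := exists_smul_project_mem_lattice j hw hw0
    refine ⟨_, hm, smul_ne_zero hu hp, hle'.trans hle, Function.update x j b, fun y hy i hi => ?_⟩
    simp only [project, PiLp.smul_apply, smul_eq_mul, ne_eq, mul_eq_zero, ite_eq_right_iff,
      Classical.not_imp, not_or] at hy
    obtain rfl | hi := Finset.mem_insert.1 hi
    · simpa using hy.2.1
    · rw [Function.update_of_ne (ne_of_mem_of_not_mem hi hj)]
      exact hx y hy.2.2 i hi

/-- The nonzero vectors of the lattice have length at least `1`. -/
theorem one_le_norm_sq {v : QState ι} (hv : v ∈ lattice ι) (h0 : v ≠ 0) : 1 ≤ ‖v‖ ^ 2 := by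
  obtain ⟨w, hw, hw0, hle, x, hx⟩ := exists_measured_mem_lattice univ hv h0
  refine le_trans ?_ hle
  have hz (y : ι → Bool) (hy : y ≠ x) : w y = 0 := by
    by_contra h
    exact hy (funext fun j => hx y h j (mem_univ j))
  have hwx : w x ≠ 0 := fun h => hw0 (by
    ext y
    obtain rfl | hy := eq_or_ne y x
    exacts [h, hz y hy])
  -- The coefficient at the zero string is a signed sum of all amplitudes. Only `w x` survives, so
  -- `w x` has the modulus of a Gaussian integer.
  obtain ⟨z, hzc⟩ := mem_lattice_iff.1 hw fun _ => false
  rw [coeff, Finset.sum_eq_single x (fun y _ hy => by rw [hz y hy, mul_zero]) (by simp)] at hzc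
  have hd : ‖∏ i, dualEntry false (x i)‖ = 1 := by
    rw [norm_prod]
    refine Finset.prod_eq_one fun i _ => ?_
    cases x i <;> simp [dualEntry]
  have hn : ‖w x‖ = ‖z.toComplex‖ := by rw [← hzc, norm_mul, hd, one_mul]
  have hz0 : z ≠ 0 := by
    rintro rfl
    simp at hn
    exact hwx hn
  rw [norm_sq_eq_sum]
  refine (one_le_norm_sq_toComplex hz0).trans ?_
  rw [← hn]
  exact Finset.single_le_sum (f := fun x => ‖w x‖ ^ 2) (fun _ _ => by positivity) (mem_univ x)

/-- Squared lengths of lattice vectors are dyadic rationals. -/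
theorem exists_nat_eq_norm_sq {v : QState ι} (hv : v ∈ lattice ι) :
    ∃ A : ℕ, ‖v‖ ^ 2 * 2 ^ Fintype.card ι = A := by
  obtain ⟨a, rfl⟩ := hv
  -- One factor `1 + i` per qubit clears the denominators; its squared modulus 2 accounts for the
  -- power of 2.
  have hent (x y : Bool) : ∃ z : GaussianInt, (1 + Complex.I) * tildeEntry x y = z.toComplex := by
    have := one_add_I_ne_zero
    cases x <;> cases y
    · exact ⟨⟨1, 1⟩, by simp [tildeEntry, GaussianInt.toComplex_def]⟩
    · exact ⟨0, by simp [tildeEntry]⟩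
    all_goals exact ⟨1, by simp [tildeEntry, this]⟩
  choose e he using hent
  have hval (y : ι → Bool) : (1 + Complex.I) ^ Fintype.card ι *
      (∑ x, GaussianInt.toComplex (a x) • tildeKet x : QState ι) y =
      (∑ x, a x * ∏ i, e (x i) (y i)).toComplex := by
    simp only [WithLp.ofLp_sum, WithLp.ofLp_smul, Finset.sum_apply, Pi.smul_apply, smul_eq_mul,
      Finset.mul_sum, tildeKet_apply, map_sum, map_mul, map_prod, ← he, Finset.prod_mul_distrib,
      Finset.prod_const, Finset.card_univ]
    exact Finset.sum_congr rfl fun _ _ => by ring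
  refine ⟨∑ y : ι → Bool, (∑ x, a x * ∏ i, e (x i) (y i)).norm.natAbs, ?_⟩
  rw [norm_sq_eq_sum, Finset.sum_mul, Nat.cast_sum]
  refine Finset.sum_congr rfl fun y _ => ?_
  rw [← Int.cast_natCast, Int.natAbs_of_nonneg (GaussianInt.norm_nonneg _),
    GaussianInt.intCast_real_norm, Complex.normSq_eq_norm_sq, ← hval, norm_mul, mul_pow, norm_pow,
    ← pow_mul, mul_comm (Fintype.card ι), pow_mul, normSq_one_add_I, mul_comm]

end MinimalNorm

/-! ### Factoring product vectors on the lattice -/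

section Tensor

variable {ι κ : Type} [Fintype ι] [Fintype κ] [DecidableEq ι] [DecidableEq κ]

theorem smul_tensor (c : ℂ) (φ : QState ι) (χ : QState κ) :
    c • tensor φ χ = tensor φ (c • χ) := by
  ext x
  simp only [tensor, PiLp.smul_apply, smul_eq_mul]
  ring

theorem norm_sq_tensor (φ : QState ι) (χ : QState κ) :
    ‖tensor φ χ‖ ^ 2 = ‖φ‖ ^ 2 * ‖χ‖ ^ 2 := by
  rw [norm_sq_eq_sum, norm_sq_eq_sum, norm_sq_eq_sum, Finset.sum_mul_sum, ← Finset.sum_product',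
    Finset.univ_product_univ, ← (Equiv.sumArrowEquivProdArrow ι κ Bool).symm.sum_comp]
  refine Finset.sum_congr rfl fun x _ => ?_
  simp [tensor, Equiv.sumArrowEquivProdArrow, mul_pow]

theorem coeff_tensor (φ : QState ι) (χ : QState κ) (x : ι → Bool) (y : κ → Bool) :
    coeff (tensor φ χ) (Sum.elim x y) = coeff φ x * coeff χ y := by
  simp only [coeff]
  rw [Finset.sum_mul_sum, ← Finset.sum_product',
    Finset.univ_product_univ, ← (Equiv.sumArrowEquivProdArrow ι κ Bool).symm.sum_comp]
  refine Finset.sum_congr rfl fun x _ => ?_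
  simp only [tensor, Equiv.sumArrowEquivProdArrow, Fintype.prod_sum_type, Equiv.coe_fn_symm_mk,
    Sum.elim_inl, Sum.elim_inr]
  ring

/-- A nonzero finite family of Gaussian integers is a multiple of a coprime family. -/
theorem exists_coprime_multiple {α : Type*} [Fintype α] (a : α → GaussianInt)
    (ha : ∃ x, a x ≠ 0) : ∃ (g : GaussianInt) (p u : α → GaussianInt), g ≠ 0 ∧
      (∀ x, a x = g * p x) ∧ ∑ x, u x * p x = 1 := by
  obtain ⟨g, hg⟩ := (IsPrincipalIdealRing.principal (Ideal.span (Set.range a))).principal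
  have hmem (x : α) : g ∣ a x := by
    rw [← Ideal.mem_span_singleton, ← Ideal.submodule_span_eq, ← hg]
    exact Ideal.subset_span ⟨x, rfl⟩
  choose p hp using hmem
  have hg0 : g ≠ 0 := by
    rintro rfl
    obtain ⟨x, hx⟩ := ha
    exact hx (by rw [hp x, zero_mul])
  have hgm : g ∈ Ideal.span (Set.range a) := by
    rw [hg]
    exact Submodule.mem_span_singleton_self g
  obtain ⟨u, hu⟩ := (Ideal.mem_span_range_iff_exists_fun).1 hgm
  refine ⟨g, p, u, hg0, hp, mul_left_cancel₀ hg0 ?_⟩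
  rw [mul_one, Finset.mul_sum, ← hu]
  refine Finset.sum_congr rfl fun x _ => ?_
  rw [hu, hp x]
  ring

/-- A product vector on the lattice is a product of two lattice vectors, the first of which
attains the Barnes–Wall norm. -/
theorem exists_factor_of_tensor_mem_lattice {φ : QState ι} {χ : QState κ}
    (h : tensor φ χ ∈ lattice (ι ⊕ κ)) (hφ : φ ≠ 0) (hχ : χ ≠ 0) :
    ∃ c : ℂ, c ≠ 0 ∧ c • φ ∈ lattice ι ∧ c⁻¹ • χ ∈ lattice κ ∧
      bwNorm φ = ENNReal.ofReal (‖c • φ‖ ^ 2) := by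
  obtain ⟨y₀, hy₀⟩ := coeff_ne_zero_of_ne_zero hχ
  have hprod (x : ι → Bool) (y : κ → Bool) :
      ∃ z : GaussianInt, coeff φ x * coeff χ y = z.toComplex := by
    obtain ⟨z, hz⟩ := mem_lattice_iff.1 h (Sum.elim x y)
    exact ⟨z, by rw [← hz, coeff_tensor]⟩
  choose a ha using hprod
  obtain ⟨x₀, hx₀⟩ := coeff_ne_zero_of_ne_zero hφ
  obtain ⟨g, p, u, hg, hp, hu⟩ := exists_coprime_multiple (fun x => a x y₀) ⟨x₀, fun h0 => by
    have := ha x₀ y₀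
    simp only [h0, map_zero, mul_eq_zero] at this
    exact this.elim hx₀ hy₀⟩
  have hg' : g.toComplex ≠ 0 := by simpa using hg
  -- This scalar makes the coefficients of `c • φ` the coprime family `p`.
  set c : ℂ := coeff χ y₀ / g.toComplex with hc
  have hc0 : c ≠ 0 := div_ne_zero hy₀ hg'
  have hcφ (x : ι → Bool) : c * coeff φ x = (p x).toComplex := by
    rw [hc, div_mul_eq_mul_div, mul_comm, ha, hp, map_mul, mul_div_cancel_left₀ _ hg']
  have hone : ∑ x, (u x).toComplex * (p x).toComplex = 1 := by
    simpa using congrArg GaussianInt.toComplex hu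
  have hmem : c • φ ∈ lattice ι := mem_lattice_iff.2 fun x => ⟨p x, by rw [coeff_smul, hcφ]⟩
  refine ⟨c, hc0, hmem, mem_lattice_iff.2 fun y => ⟨∑ x, u x * a x y, ?_⟩, le_antisymm ?_ ?_⟩
  -- Inserting the Bézout relation `∑ u p = 1` expresses each coefficient of `c⁻¹ • χ` through the
  -- integral products `a x y`.
  · rw [coeff_smul, ← one_mul (c⁻¹ * _), ← hone, Finset.sum_mul, map_sum]
    refine Finset.sum_congr rfl fun x _ => ?_
    rw [map_mul, ← ha, ← hcφ]
    field_simp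
  · exact sInf_le ⟨c, hc0, hmem, rfl⟩
  · refine le_sInf ?_
    rintro _ ⟨d, hd0, hd, rfl⟩
    have hd' (x : ι → Bool) : ∃ z : GaussianInt, d * coeff φ x = z.toComplex := by
      obtain ⟨z, hz⟩ := mem_lattice_iff.1 hd x
      exact ⟨z, by rw [← hz, coeff_smul]⟩
    choose q hq using hd'
    -- By the same relation, every admissible `d` is a Gaussian-integer multiple of `c`, so `c`
    -- gives the shortest vector.
    have hratio : d / c = (∑ x, u x * q x).toComplex := by
      rw [← mul_one (d / c), ← hone, Finset.mul_sum, map_sum]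
      refine Finset.sum_congr rfl fun x _ => ?_
      rw [map_mul, ← hq, ← hcφ]
      field_simp
    have hz : ∑ x, u x * q x ≠ 0 := by
      intro h0
      rw [h0, map_zero] at hratio
      exact div_ne_zero hd0 hc0 hratio
    have h1 := one_le_norm_sq_toComplex hz
    rw [← hratio, norm_div, div_pow, one_le_div (by positivity)] at h1
    apply ENNReal.ofReal_le_ofReal
    rw [norm_smul, norm_smul, mul_pow, mul_pow]
    gcongr

end Tensor

/-! ### Length of lattice multiples along a protocol -/

section Protocols

variable {ι : Type} [Fintype ι] [DecidableEq ι]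

theorem ketZero_eq_tildeKet : ketZero ι = tildeKet fun _ => false := by
  ext y
  have h := prod_ite_eq_one y fun _ => false
  rw [tildeKet_apply]
  simp only [ketZero]
  rw [← h]
  refine Finset.prod_congr rfl fun i _ => ?_
  cases y i <;> simp [tildeEntry]

theorem norm_ketZero : ‖ketZero ι‖ = 1 := by
  rw [← sq_eq_sq₀ (norm_nonneg _) zero_le_one, norm_sq_eq_sum]
  simp only [ketZero]
  rw [Finset.sum_eq_single (fun _ => false)] <;> simp +contextual

theorem Protocol.exists_final_of_measurementFree (P : Protocol ι) (hP : P.MeasurementFree)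
    {ψ : QState ι} {c : ℂ} (hc : c ≠ 0) (hψ : c • ψ ∈ lattice ι) (h0 : ψ ≠ 0) :
    ∃ Ψ ∈ P.finals ψ, Ψ ≠ 0 ∧ ∃ d : ℂ, d ≠ 0 ∧ d • Ψ ∈ lattice ι ∧
      ‖d • Ψ‖ ^ 2 = 2 ^ P.csCount * ‖c • ψ‖ ^ 2 := by
  induction P generalizing ψ c with
  | done => exact ⟨ψ, rfl, h0, c, hc, hψ, by simp [Protocol.csCount]⟩
  | gate g P ih =>
    obtain ⟨u, hu, hg⟩ := exists_smul_gate_apply_mem_lattice g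
    have hu0 : u ≠ 0 := by
      rintro rfl
      rw [norm_zero, zero_pow two_ne_zero] at hu
      exact pow_ne_zero _ two_ne_zero hu.symm
    have hm := hg _ hψ
    rw [gate_apply_smul, smul_smul] at hm
    have hg0 : g.apply ψ ≠ 0 := by
      rw [← norm_ne_zero_iff, norm_gate_apply]
      exact norm_ne_zero_iff.2 h0
    obtain ⟨Ψ, hΨ, hΨ0, d, hd, hdm, hn⟩ := ih hP (mul_ne_zero hu0 hc) hm hg0
    refine ⟨Ψ, hΨ, hΨ0, d, hd, hdm, hn.trans ?_⟩
    rw [Protocol.csCount, pow_add, ← hu]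
    simp only [norm_smul, norm_mul, norm_gate_apply]
    ring
  | measure j P ih => exact hP.elim

/-- One good branch suffices, as `Prepares` constrains all of them. Only measurements turn the
equality into an inequality. -/
theorem Protocol.exists_final (P : Protocol ι)
    {ψ : QState ι} {c : ℂ} (hc : c ≠ 0) (hψ : c • ψ ∈ lattice ι) (h0 : ψ ≠ 0) :
    ∃ Ψ ∈ P.finals ψ, Ψ ≠ 0 ∧ ∃ d : ℂ, d ≠ 0 ∧ d • Ψ ∈ lattice ι ∧
      ‖d • Ψ‖ ^ 2 ≤ 2 ^ P.csCount * ‖c • ψ‖ ^ 2 := by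
  induction P generalizing ψ c with
  | done => exact ⟨ψ, rfl, h0, c, hc, hψ, by simp [Protocol.csCount]⟩
  | gate g P ih =>
    obtain ⟨u, hu, hg⟩ := exists_smul_gate_apply_mem_lattice g
    have hu0 : u ≠ 0 := by
      rintro rfl
      rw [norm_zero, zero_pow two_ne_zero] at hu
      exact pow_ne_zero _ two_ne_zero hu.symm
    have hm := hg _ hψ
    rw [gate_apply_smul, smul_smul] at hm
    have hg0 : g.apply ψ ≠ 0 := by
      rw [← norm_ne_zero_iff, norm_gate_apply]
      exact norm_ne_zero_iff.2 h0
    obtain ⟨Ψ, hΨ, hΨ0, d, hd, hdm, hn⟩ := ih (mul_ne_zero hu0 hc) hm hg0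
    refine ⟨Ψ, hΨ, hΨ0, d, hd, hdm, hn.trans (le_of_eq ?_)⟩
    rw [Protocol.csCount, pow_add, ← hu]
    simp only [norm_smul, norm_mul, norm_gate_apply]
    ring
  | measure j P ih =>
    obtain ⟨b, u, hu, hp, hm, hle⟩ :=
      exists_smul_project_mem_lattice j hψ (smul_ne_zero hc h0)
    rw [project_smul] at hp
    rw [project_smul, smul_smul] at hm hle
    obtain ⟨Ψ, hΨ, hΨ0, d, hd, hdm, hn⟩ := ih b (mul_ne_zero hu hc) hm (right_ne_zero_of_smul hp)
    refine ⟨Ψ, Set.mem_iUnion.2 ⟨b, hΨ⟩, hΨ0, d, hd, hdm, hn.trans ?_⟩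
    have hcount : (P b).csCount ≤ (Protocol.measure j P).csCount := by
      cases b
      exacts [le_max_left _ _, le_max_right _ _]
    gcongr
    exact one_le_two

end Protocols

/-! ### The norm of `|CS⟩` and the two bounds -/

section Conclusion

/-- The vector is `(1+i) CS |1̃1̃⟩`. -/
theorem smul_ketCS_mem_lattice : (1 - Complex.I) • ketCS ∈ lattice (Fin 2) := by
  have h := smul_CS_mem_lattice (0 : Fin 2) 1 (by decide)
    (tildeKet_mem_lattice fun _ => true)
  convert h using 1
  ext y
  have := one_add_I_ne_zero
  simp only [Gate.apply, PiLp.smul_apply, smul_eq_mul, tildeKet_apply, ketCS, tildeEntry,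
    Fin.prod_univ_two, if_true]
  have e : (1 - Complex.I) * (1 / 2) =
      (1 + Complex.I) * (1 / (1 + Complex.I) * (1 / (1 + Complex.I))) := by
    field_simp
    linear_combination (-1 : ℂ) * Complex.I_sq
  rw [← mul_assoc, e]
  ring

theorem norm_ketCS : ‖ketCS‖ = 1 := by
  rw [← sq_eq_sq₀ (norm_nonneg _) zero_le_one, norm_sq_eq_sum]
  have h (x : Fin 2 → Bool) : ‖ketCS x‖ ^ 2 = 1 / 4 := by
    simp only [ketCS]
    split <;> norm_num
  simp only [h]
  norm_num

/-- Its squared modulus is `1/2`, so this one coefficient already forces `‖c‖² ≥ 2` for any nonzero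
`c` with `c • ketCS` on the lattice. -/
theorem coeff_ketCS : coeff ketCS (fun _ => false) = -(1 - Complex.I) / 2 := by
  rw [coeff, ← (finTwoArrowEquiv Bool).symm.sum_comp, Fintype.sum_prod_type]
  simp [ketCS, dualEntry, finTwoArrowEquiv]
  ring

theorem bwNorm_ketCS : bwNorm ketCS = 2 := by
  have hI : ‖(1 - Complex.I : ℂ)‖ ^ 2 = 2 := by
    rw [← Complex.normSq_eq_norm_sq]
    norm_num [Complex.normSq_apply]
  refine le_antisymm (sInf_le ⟨1 - Complex.I, ?_, smul_ketCS_mem_lattice, ?_⟩) (le_sInf ?_)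
  · intro h
    simp [h] at hI
  · rw [norm_smul, norm_ketCS, mul_one, hI]
    simp
  · rintro _ ⟨c, hc, hm, rfl⟩
    rw [norm_smul, norm_ketCS, mul_one]
    obtain ⟨z, hz⟩ := mem_lattice_iff.1 hm fun _ => false
    rw [coeff_smul, coeff_ketCS] at hz
    have hn : ‖z.toComplex‖ ^ 2 = ‖c‖ ^ 2 / 2 := by
      rw [← hz, norm_mul, norm_div, norm_neg, mul_pow, div_pow, hI, Complex.norm_ofNat]
      ring
    have hz0 : z ≠ 0 := by
      rintro rfl
      simp only [map_zero, norm_zero] at hn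
      have := norm_pos_iff.2 hc
      have : 0 < ‖c‖ ^ 2 / 2 := by positivity
      linarith
    have h1 := one_le_norm_sq_toComplex hz0
    have h2 : (2 : ℝ) ≤ ‖c‖ ^ 2 := by linarith
    calc (2 : ENNReal) = ENNReal.ofReal 2 := by simp
      _ ≤ _ := ENNReal.ofReal_le_ofReal h2

/-- The squared length of a nonzero product vector on the lattice is the product of the squared
lengths of two lattice vectors, the first of which is the Barnes–Wall norm of the first factor. -/
theorem exists_norm_sq_factor {n a : ℕ} {φ : QState (Fin n)} {χ : QState (Fin a)}
    (h : tensor φ χ ∈ lattice (Fin n ⊕ Fin a)) (h0 : tensor φ χ ≠ 0) :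
    ∃ v ∈ lattice (Fin n), ∃ w ∈ lattice (Fin a), 1 ≤ ‖v‖ ^ 2 ∧ 1 ≤ ‖w‖ ^ 2 ∧
      bwNorm φ = ENNReal.ofReal (‖v‖ ^ 2) ∧ ‖tensor φ χ‖ ^ 2 = ‖v‖ ^ 2 * ‖w‖ ^ 2 := by
  have hn : ‖φ‖ ^ 2 * ‖χ‖ ^ 2 ≠ 0 := by
    rw [← norm_sq_tensor]
    exact pow_ne_zero 2 (norm_ne_zero_iff.2 h0)
  have hφ : φ ≠ 0 := by
    rintro rfl
    simp at hn
  have hχ : χ ≠ 0 := by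
    rintro rfl
    simp at hn
  obtain ⟨c, hc, hv, hw, hbw⟩ := exists_factor_of_tensor_mem_lattice h hφ hχ
  refine ⟨_, hv, _, hw, one_le_norm_sq hv (smul_ne_zero hc hφ),
    one_le_norm_sq hw (smul_ne_zero (inv_ne_zero hc) hχ), hbw, ?_⟩
  have hc' : ‖c‖ ≠ 0 := norm_ne_zero_iff.2 hc
  rw [norm_sq_tensor, norm_smul, norm_smul, norm_inv]
  field_simp

/-- `A` divides a power of 2, so `r` is a possibly negative power of 2; `1 ≤ r` makes the exponent
nonnegative and `1 ≤ s` bounds it by `k`. -/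
theorem exists_dvd_of_dyadic_mul_eq {r s : ℝ} {k n a A B : ℕ} (hr : 1 ≤ r) (hs : 1 ≤ s)
    (hA : r * 2 ^ n = A) (hB : s * 2 ^ a = B) (h : r * s = 2 ^ k) :
    ∃ d : ℕ, r = d ∧ d ∣ 2 ^ k := by
  have hAB : A * B = 2 ^ (k + n + a) := by
    have : (A : ℝ) * B = 2 ^ (k + n + a) := by
      rw [← hA, ← hB, pow_add, pow_add, ← h]
      ring
    exact_mod_cast this
  obtain ⟨i, -, hi⟩ := (Nat.dvd_prime_pow Nat.prime_two).1 (Dvd.intro _ hAB)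
  have hA' : r * 2 ^ n = 2 ^ i := by rw [hA, hi]; simp
  have hni : n ≤ i := by
    have : (2 : ℝ) ^ n ≤ 2 ^ i := by
      rw [← hA']
      exact le_mul_of_one_le_left (by positivity) hr
    exact (pow_le_pow_iff_right₀ one_lt_two).1 this
  obtain ⟨e, rfl⟩ := Nat.exists_eq_add_of_le hni
  have hre : r = 2 ^ e := by
    rw [pow_add, mul_comm] at hA'
    exact mul_left_cancel₀ (by positivity) hA'
  refine ⟨2 ^ e, by simp [hre], pow_dvd_pow 2 ?_⟩
  have : (2 : ℝ) ^ e ≤ 2 ^ k := by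
    rw [← h, ← hre]
    exact le_mul_of_one_le_right (by linarith) hs
  exact (pow_le_pow_iff_right₀ one_lt_two).1 this

variable {n a : ℕ} {φ : QState (Fin n)} {P : Protocol (Fin n ⊕ Fin a)}

theorem one_smul_ketZero_mem_lattice {ι : Type} [Fintype ι] [DecidableEq ι] :
    (1 : ℂ) • ketZero ι ∈ lattice ι := by
  rw [one_smul, ketZero_eq_tildeKet]
  exact tildeKet_mem_lattice _

theorem ketZero_ne_zero {ι : Type} [Fintype ι] [DecidableEq ι] : ketZero ι ≠ 0 := by
  rw [← norm_ne_zero_iff, norm_ketZero]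
  exact one_ne_zero

theorem Protocol.Prepares.bwNorm_dvd (h : P.Prepares φ) (hP : P.MeasurementFree) :
    ∃ d : ℕ, bwNorm φ = (d : ENNReal) ∧ d ∣ 2 ^ P.csCount := by
  obtain ⟨Ψ, hΨ, hΨ0, c, hc, hm, hn⟩ := P.exists_final_of_measurementFree hP one_ne_zero
    one_smul_ketZero_mem_lattice ketZero_ne_zero
  obtain ⟨χ, rfl⟩ := h Ψ hΨ hΨ0
  have h0 := smul_ne_zero hc hΨ0
  rw [smul_tensor] at hm hn h0
  obtain ⟨v, hv, w, hw, hv1, hw1, hbw, hvw⟩ := exists_norm_sq_factor hm h0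
  obtain ⟨A, hA⟩ := exists_nat_eq_norm_sq hv
  obtain ⟨B, hB⟩ := exists_nat_eq_norm_sq hw
  rw [hvw, one_smul, norm_ketZero, one_pow, mul_one] at hn
  obtain ⟨d, hd, hdvd⟩ := exists_dvd_of_dyadic_mul_eq hv1 hw1 hA hB hn
  exact ⟨d, by rw [hbw, hd, ENNReal.ofReal_natCast], hdvd⟩

theorem Protocol.Prepares.bwNorm_le (h : P.Prepares φ) : bwNorm φ ≤ 2 ^ P.csCount := by
  obtain ⟨Ψ, hΨ, hΨ0, c, hc, hm, hn⟩ := P.exists_final one_ne_zero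
    one_smul_ketZero_mem_lattice ketZero_ne_zero
  obtain ⟨χ, rfl⟩ := h Ψ hΨ hΨ0
  have h0 := smul_ne_zero hc hΨ0
  rw [smul_tensor] at hm hn h0
  obtain ⟨v, hv, w, hw, hv1, hw1, hbw, hvw⟩ := exists_norm_sq_factor hm h0
  rw [hvw, one_smul, norm_ketZero, one_pow, mul_one] at hn
  rw [hbw]
  calc ENNReal.ofReal (‖v‖ ^ 2) ≤ ENNReal.ofReal (2 ^ P.csCount) :=
        ENNReal.ofReal_le_ofReal ((le_mul_of_one_le_right (by positivity) hw1).trans hn)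
    _ = 2 ^ P.csCount := by
        rw [ENNReal.ofReal_pow zero_le_two, ENNReal.ofReal_ofNat]

end Conclusion

end BarnesWall
end

theorem theorem6 :
    BarnesWall.bwNorm BarnesWall.ketCS = 2 ∧
    ∀ (n a m : ℕ) (φ : BarnesWall.QState (Fin n)), ‖φ‖ = 1 →
      ∀ P : BarnesWall.Protocol (Fin n ⊕ Fin a), P.Prepares φ → P.csCount ≤ m →
        (P.MeasurementFree → ∃ d : ℕ, BarnesWall.bwNorm φ = (d : ENNReal) ∧ d ∣ 2 ^ m) ∧
        BarnesWall.bwNorm φ ≤ 2 ^ m := by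
  refine ⟨BarnesWall.bwNorm_ketCS, fun n a m φ _ P hP hm => ⟨fun hfree => ?_, ?_⟩⟩
  · obtain ⟨d, hd, hdvd⟩ := hP.bwNorm_dvd hfree
    exact ⟨d, hd, hdvd.trans (pow_dvd_pow 2 hm)⟩
  · exact hP.bwNorm_le.trans (pow_le_pow_right₀ one_le_two hm)
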